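/- Let $G=(C\cup S,E)$ be a finite bipartite graph with $n=|C|$ clients and server set $S$, in which every client has at least one neighbour. An assignment $\mathcal A$ of a set of clients sends each client of the set to one of its neighbouring servers; the load of a server is the number of clients assigned to it, $\ell(\mathcal A)$ is the maximum load of a server, and $\mathrm{OPT}$ of a graph is the minimum of $\ell(\mathcal A)$ over all assignments $\mathcal A$ of its clients. The clients are inserted one by one, in an arbitrary order, each with all its incident edges; let $G_t$ be the graph after $t$ insertions, so that $G_n=G$. The SAP protocol starts with the empty assignment and handles the $t$-th inserted client $c$ as follows. If $\mathrm{OPT}(G_t)>\mathrm{OPT}(G_{t-1})$, it assigns $c$ to an arbitrary neighbour. Otherwise it takes a shortest augmenting path from $c$, that is, a shortest path that starts in $c$, alternates between edges $(c',s')$ of $G_t$ such that $c'$ is not assigned to $s'$ and edges such that $c'$ is assigned to $s'$, and ends, with an edge of the former kind, in a server of load less than $\mathrm{OPT}(G_t)$; and it exchanges the assigned and the non-assigned edges of this path (if there is no augmenting path, it does nothing). Ties are broken arbitrarily. A reassignment is a change, during an insertion, of the server of a client that was inserted earlier. Let $L=\mathrm{OPT}(G)$. Then, for every order of insertion and all choices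 made by SAP, after each number $t$ of insertions SAP holds an assignment $\mathcal A_t$ of all the clients inserted so far with $\ell(\mathcal A_t)=\mathrm{OPT}(G_t)$, and the total number of reassignments made by SAP is $O\bigl(n\cdot\min\{L\log^2 n,\ \sqrt n\,\log n\}\bigr)$, where the constant in the $O$ is absolute. -/

import Mathlib

namespace OnlineAssignment

open Classical in
/-- The load of the server `s`: the number of clients assigned to it.
An assignment is stored as a function `A : C → Option S`; `A c = some s` means that `c` is
assigned to `s`, and `A c = none` means that `c` is not assigned (e.g. has not arrived yet). -/
noncomputable def load {C S : Type*} [Fintype C] (A : C → Option S) (s : S) : ℕ :=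
  (Finset.univ.filter fun c => A c = some s).card

/-- The maximum server load of `A`. -/
noncomputable def maxLoad {C S : Type*} [Fintype C] [Fintype S] (A : C → Option S) : ℕ :=
  Finset.univ.sup (load A)

/-- `A` is an assignment of the client set `P` in the bipartite graph with edge relation `E`:
exactly the clients in `P` are assigned, and each of them to one of its neighbours. -/
def IsAssignment {C S : Type*} (E : C → S → Prop) (P : Finset C) (A : C → Option S) : Prop :=
  (∀ c, c ∈ P ↔ ∃ s, A c = some s) ∧ ∀ c s, A c = some s → E c s

/-- The minimum possible maximum load in the subgraph with client set `P`
(meaningful when every client in `P` has a neighbour, so that an assignment exists). -/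
noncomputable def opt {C S : Type*} [Fintype C] [Fintype S] (E : C → S → Prop)
    (P : Finset C) : ℕ :=
  sInf {b | ∃ A : C → Option S, IsAssignment E P A ∧ maxLoad A = b}

/-- The path `x 0, y 0, x 1, y 1, …, x k, y k` (with `2 * k + 1` edges) is an augmenting path
from the unassigned client `c` with respect to `A`, where every server has capacity `b`:
its vertices are distinct, the edges `x i, y i` are non-assigned edges of the graph, the edges
`y i, x (i + 1)` are assigned ones, and the last server has load less than `b`. -/
structure IsAugmentingPath {C S : Type*} [Fintype C] (E : C → S → Prop) (A : C → Option S)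
    (b : ℕ) (c : C) (k : ℕ) (x : Fin (k + 1) → C) (y : Fin (k + 1) → S) : Prop where
  start : x 0 = c
  source : A c = none
  client_injective : Function.Injective x
  server_injective : Function.Injective y
  edge : ∀ i, E (x i) (y i)
  nonassigned : ∀ i, A (x i) ≠ some (y i)
  assigned : ∀ i : Fin k, A (x i.succ) = some (y i.castSucc)
  target : load A (y (Fin.last k)) < b

/-- `A'` results from `A` by augmenting down the path `x 0, y 0, …, x k, y k`. -/
def IsAugmentation {C S : Type*} (A A' : C → Option S) (k : ℕ) (x : Fin (k + 1) → C)
    (y : Fin (k + 1) → S) : Prop :=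
  (∀ i, A' (x i) = some (y i)) ∧ ∀ d, (∀ i, x i ≠ d) → A' d = A d

/-- `A'` results from `A` by an augmentation down a shortest augmenting path from `c` to a server
of load less than `b`. -/
def IsShortestAugmentation {C S : Type*} [Fintype C] (E : C → S → Prop) (b : ℕ) (c : C)
    (A A' : C → Option S) : Prop :=
  ∃ (k : ℕ) (x : Fin (k + 1) → C) (y : Fin (k + 1) → S),
    IsAugmentingPath E A b c k x y ∧
    (∀ (k' : ℕ) (x' : Fin (k' + 1) → C) (y' : Fin (k' + 1) → S),
      IsAugmentingPath E A b c k' x' y' → k ≤ k') ∧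
    IsAugmentation A A' k x y

open Classical in
/-- One step of SAP: the client set changes from `P` to `P ∪ {c}`, and `A'` is a possible
successor of `A`. If the optimum increases, `c` is assigned to an arbitrary neighbour and nothing
else changes. Otherwise SAP augments down a shortest augmenting path from `c` to a server whose
load is less than the optimum, if there is an augmenting path, and does nothing if there is none. -/
def SAPStep {C S : Type*} [Fintype C] [Fintype S] (E : C → S → Prop) (P : Finset C) (c : C)
    (A A' : C → Option S) : Prop :=
  if opt E P < opt E (insert c P) then
    ∃ s, E c s ∧ A' = Function.update A c (some s)
  else if ∃ (k : ℕ) (x : Fin (k + 1) → C) (y : Fin (k + 1) → S),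
      IsAugmentingPath E A (opt E (insert c P)) c k x y then
    IsShortestAugmentation E (opt E (insert c P)) c A A'
  else A' = A

/-- The clients are `0, 1, …, n - 1`, in the order of arrival; these are the first `t` of them. -/
def arrived (n t : ℕ) : Finset (Fin n) :=
  Finset.univ.filter fun i => i.val < t

/-- `A 0, A 1, …, A n` is a possible execution of SAP on the bipartite graph with clients
`0, 1, …, n - 1`, inserted in this order, and edge relation `E`; `A t` is what SAP holds after
`t` insertions. -/
def IsSAPRun {n : ℕ} {S : Type*} [Fintype S] (E : Fin n → S → Prop)
    (A : Fin (n + 1) → Fin n → Option S) : Prop :=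
  (∀ c, A 0 c = none) ∧
    ∀ t : Fin n, SAPStep E (arrived n t.val) t (A t.castSucc) (A t.succ)

open Classical in
/-- The total number of reassignments: over all insertions, the number of clients that arrived
earlier and whose server is changed during this insertion. -/
noncomputable def totalReassignments {n : ℕ} {S : Type*}
    (A : Fin (n + 1) → Fin n → Option S) : ℕ :=
  ∑ t : Fin n, ((arrived n t.val).filter fun d => A t.succ d ≠ A t.castSucc d).card

end OnlineAssignment

namespace OnlineAssignment

/-! SAP never gets stuck, by Hall's condition: without an augmenting path, all servers reachable
from the new client would have load at least OPT, and their clients together with the new one would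
be too many for these servers, the only ones they can use (`exists_isAugmentingPath`).

The count rests on a potential. Fix a value b of the optimum, a length k and δ = log n / k < 1, and
let the excess be the maximum of |K| - (1 - δ) b |N(K)| over sets K of arrived clients. It never
decreases, and while the optimum is b it is at most δ n, because |K| ≤ b |N(K)|. An insertion at
optimum b with more than k reassignments raises it by at least one (`excess_add_one_le`). Indeed,
let K be a maximiser. If N(K) contains all neighbours of the new client, add the client to K.
Otherwise search from a neighbour outside N(K), through saturated servers: maximality of K makes
each layer outside N(K) at least 1 / (1 - δ) times as large as the previous one, so k layers would
outgrow n. Hence each b admits at most n log n / k such insertions (`IsSAPRun.card_long_le`).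

Moreover k saturated servers need k b ≤ n clients, so only min(L, n / k) values of b matter. Summing
over k ≥ 1 with L gives n L log² n; summing over k ≥ √n with n / k, and charging √n to every
insertion, gives n √n log n. -/

open Classical in
/-- The servers that have a neighbour in `K`. -/
noncomputable def neighbours {C S : Type*} [Fintype S] (E : C → S → Prop) (K : Finset C) :
    Finset S :=
  Finset.univ.filter fun s => ∃ c ∈ K, E c s

theorem mem_neighbours {C S : Type*} [Fintype S] {E : C → S → Prop} {K : Finset C} {s : S} :
    s ∈ neighbours E K ↔ ∃ c ∈ K, E c s := by
  simp [neighbours]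

open Classical in
/-- The clients that `A` assigns to a server in `T`. -/
noncomputable def clientsOf {C S : Type*} [Fintype C] (A : C → Option S) (T : Finset S) :
    Finset C :=
  Finset.univ.filter fun c => ∃ s ∈ T, A c = some s

theorem mem_clientsOf {C S : Type*} [Fintype C] {A : C → Option S} {T : Finset S} {c : C} :
    c ∈ clientsOf A T ↔ ∃ s ∈ T, A c = some s := by
  simp [clientsOf]

/-- `s` is the end of an alternating walk from `c` that uses `i` assigned edges. -/
def Reach {C S : Type*} (E : C → S → Prop) (A : C → Option S) (c : C) : ℕ → S → Prop
  | 0, s => E c s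
  | i + 1, s => ∃ s' d, Reach E A c i s' ∧ A d = some s' ∧ E d s

open Classical in
theorem exists_isAssignment {C S : Type*} {E : C → S → Prop} (hE : ∀ c, ∃ s, E c s) (P : Finset C) :
    ∃ A : C → Option S, IsAssignment E P A := by
  choose f hf using hE
  refine ⟨fun c => if c ∈ P then some (f c) else none, fun c => ?_, fun c s h => ?_⟩
  · by_cases hc : c ∈ P <;> simp [hc]
  · by_cases hc : c ∈ P
    · simp only [hc, if_true, Option.some.injEq] at h
      exact h ▸ hf c
    · simp [hc] at h

/-! ### Loads, the optimum and Hall's condition -/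

section Loads

variable {C S : Type*} [Fintype C]

open Classical in
theorem load_eq (A : C → Option S) (s : S) :
    load A s = (Finset.univ.filter fun c => A c = some s).card := by
  unfold load
  congr

open Classical in
theorem card_clientsOf (A : C → Option S) (T : Finset S) :
    (clientsOf A T).card = ∑ s ∈ T, load A s := by
  have : clientsOf A T = T.biUnion fun s => Finset.univ.filter fun c => A c = some s := by
    ext c
    simp [mem_clientsOf]
  rw [this, Finset.card_biUnion]
  · simp only [load_eq]
  · intro s _ s' _ hss
    refine Finset.disjoint_left.2 fun c hc hc' => hss ?_
    simp only [Finset.mem_filter, Finset.mem_univ, true_and] at hc hc'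
    exact Option.some_injective _ (hc.symm.trans hc')

theorem load_le_maxLoad [Fintype S] (A : C → Option S) (s : S) : load A s ≤ maxLoad A :=
  Finset.le_sup (f := load A) (Finset.mem_univ s)

theorem maxLoad_le [Fintype S] {A : C → Option S} {b : ℕ} (h : ∀ s, load A s ≤ b) :
    maxLoad A ≤ b :=
  Finset.sup_le fun s _ => h s

theorem opt_le_maxLoad [Fintype S] {E : C → S → Prop} {P : Finset C} {A : C → Option S}
    (h : IsAssignment E P A) : opt E P ≤ maxLoad A :=
  Nat.sInf_le ⟨A, h, rfl⟩

theorem exists_isAssignment_maxLoad_eq_opt [Fintype S] {E : C → S → Prop}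
    (hE : ∀ c, ∃ s, E c s) (P : Finset C) :
    ∃ A : C → Option S, IsAssignment E P A ∧ maxLoad A = opt E P := by
  obtain ⟨A, hA⟩ := exists_isAssignment hE P
  exact Nat.sInf_mem (s := {b | ∃ A : C → Option S, IsAssignment E P A ∧ maxLoad A = b})
    ⟨_, A, hA, rfl⟩

open Classical in
theorem opt_mono [Fintype S] {E : C → S → Prop} (hE : ∀ c, ∃ s, E c s) {P Q : Finset C}
    (h : P ⊆ Q) : opt E P ≤ opt E Q := by
  obtain ⟨A, hA, hAQ⟩ := exists_isAssignment_maxLoad_eq_opt hE Q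
  have hB : IsAssignment E P fun c => if c ∈ P then A c else none := by
    refine ⟨fun c => ?_, fun c s hs => ?_⟩
    · by_cases hc : c ∈ P
      · simpa [hc] using (hA.1 c).1 (h hc)
      · simp [hc]
    · by_cases hc : c ∈ P
      · simp only [hc, if_true] at hs
        exact hA.2 c s hs
      · simp [hc] at hs
  refine (opt_le_maxLoad hB).trans (hAQ ▸ maxLoad_le fun s => ?_)
  refine le_trans ?_ (load_le_maxLoad A s)
  rw [load_eq, load_eq]
  refine Finset.card_le_card fun c hc => ?_
  simp only [Finset.mem_filter, Finset.mem_univ, true_and] at hc ⊢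
  by_cases hcP : c ∈ P
  · simpa [hcP] using hc
  · simp [hcP] at hc

theorem card_le_mul_card_neighbours [Fintype S] {E : C → S → Prop} {P K : Finset C}
    {A : C → Option S} {b : ℕ} (hA : IsAssignment E P A) (hb : maxLoad A ≤ b) (hK : K ⊆ P) :
    K.card ≤ b * (neighbours E K).card := by
  have h1 : K ⊆ clientsOf A (neighbours E K) := fun c hc => by
    obtain ⟨s, hs⟩ := (hA.1 c).1 (hK hc)
    exact mem_clientsOf.2 ⟨s, mem_neighbours.2 ⟨c, hc, hA.2 c s hs⟩, hs⟩
  calc K.card ≤ (clientsOf A (neighbours E K)).card := Finset.card_le_card h1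
    _ = ∑ s ∈ neighbours E K, load A s := card_clientsOf _ _
    _ ≤ ∑ s ∈ neighbours E K, b :=
        Finset.sum_le_sum fun s _ => (load_le_maxLoad A s).trans hb
    _ = b * (neighbours E K).card := by simp [mul_comm]

end Loads

/-! ### Alternating walks, augmenting paths and one step of SAP -/

section Augmentation

variable {C S : Type*} [Fintype C] {E : C → S → Prop} {A A' : C → Option S} {b : ℕ} {c : C}

omit [Fintype C] in
-- Minimality of the index is inherited by the predecessor on the walk: reaching it earlier would
-- mean reaching `s` earlier.
theorem exists_walk_of_reach (i : ℕ) (s : S) (h : Reach E A c i s)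
    (hmin : ∀ j < i, ¬ Reach E A c j s) :
    ∃ (x : ℕ → C) (y : ℕ → S), x 0 = c ∧ y i = s ∧ (∀ j ≤ i, E (x j) (y j)) ∧
      (∀ j < i, A (x (j + 1)) = some (y j)) ∧
      ∀ j ≤ i, Reach E A c j (y j) ∧ ∀ j' < j, ¬ Reach E A c j' (y j) := by
  induction i generalizing s with
  | zero =>
    refine ⟨fun _ => c, fun _ => s, rfl, rfl, ?_, by simp, ?_⟩
    · intro j _
      exact h
    · intro j hj
      obtain rfl : j = 0 := by omega
      exact ⟨h, by simp⟩
  | succ i ih =>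
    obtain ⟨s', d, hs', hd, hds⟩ := h
    obtain ⟨x, y, hx, hy, hE, hA, hR⟩ := ih s' hs' fun j hj hjs =>
      hmin (j + 1) (by omega) ⟨s', d, hjs, hd, hds⟩
    refine ⟨fun j => if j = i + 1 then d else x j, fun j => if j = i + 1 then s else y j,
      by simpa using hx, by simp, fun j hj => ?_, fun j hj => ?_, fun j hj => ?_⟩
    · by_cases hji : j = i + 1
      · simpa [hji] using hds
      · simpa [hji] using hE j (by omega)
    · have h1 : j ≠ i + 1 := by omega
      by_cases hji : j = i
      · simp [hji, hd, hy]
      · simpa [hji, h1] using hA j (by omega)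
    · by_cases hji : j = i + 1
      · subst hji
        simp only [if_true]
        exact ⟨⟨s', d, hs', hd, hds⟩, hmin⟩
      · simpa [hji] using hR j (by omega)

/-- A shortest walk is a path: its servers have different distances from `c`, its later clients are
told apart by the servers that hold them, and `c` itself is unassigned. -/
theorem exists_isAugmentingPath_of_reach {i : ℕ} {s : S} (hc : A c = none)
    (h : Reach E A c i s) (hs : load A s < b) :
    ∃ k ≤ i, ∃ (x : Fin (k + 1) → C) (y : Fin (k + 1) → S),
      IsAugmentingPath E A b c k x y := by
  classical
  have hex : ∃ k, Reach E A c k s := ⟨i, h⟩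
  obtain ⟨x, y, hx, hy, hE, hA, hR⟩ := exists_walk_of_reach (Nat.find hex) s
    (Nat.find_spec hex) fun j hj => Nat.find_min hex hj
  set k := Nat.find hex
  have hyinj : ∀ j ≤ k, ∀ j' ≤ k, y j = y j' → j = j' := by
    intro j hj j' hj' hjj
    rcases lt_trichotomy j j' with hlt | heq | hlt
    · exact absurd (hjj ▸ (hR j hj).1) ((hR j' hj').2 j hlt)
    · exact heq
    · exact absurd (hjj ▸ (hR j' hj').1) ((hR j hj).2 j' hlt)
  refine ⟨k, Nat.find_min' hex h, fun j => x j, fun j => y j,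
    ⟨hx, hc, ?_, ?_, ?_, ?_, ?_, ?_⟩⟩
  · rintro ⟨j, hj⟩ ⟨j', hj'⟩ hjj
    simp only [Fin.mk.injEq] at hjj ⊢
    rcases j with _ | j <;> rcases j' with _ | j'
    · rfl
    · have := hA j' (by omega)
      rw [← hjj, hx, hc] at this
      simp at this
    · have := hA j (by omega)
      rw [hjj, hx, hc] at this
      simp at this
    · have h1 := hA j (by omega)
      rw [hjj, hA j' (by omega), Option.some.injEq] at h1
      rw [hyinj j' (by omega) j (by omega) h1]
  · rintro ⟨j, hj⟩ ⟨j', hj'⟩ hjj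
    exact Fin.ext (hyinj j (by omega) j' (by omega) hjj)
  · intro j
    exact hE j (by omega)
  · rintro ⟨j, hj⟩
    rcases j with _ | j
    · simp [hx, hc]
    · intro hA'
      simp only [hA j (by omega), Option.some.injEq] at hA'
      have := hyinj j (by omega) (j + 1) (by omega) hA'
      omega
  · intro j
    simpa using hA j j.2
  · simpa [hy] using hs

theorem IsAugmentingPath.reach {k : ℕ} {x : Fin (k + 1) → C} {y : Fin (k + 1) → S}
    (h : IsAugmentingPath E A b c k x y) (i : Fin (k + 1)) : Reach E A c i (y i) := by
  induction i using Fin.induction with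
  | zero => simpa [Reach, h.start] using h.edge 0
  | succ i ih => exact ⟨_, _, ih, h.assigned i, h.edge _⟩

open Classical in
theorem exists_isAugmentingPath [Fintype S] {P : Finset C} (hE : ∀ c, ∃ s, E c s)
    (hA : IsAssignment E P A) (hc : c ∉ P) (hb : opt E (insert c P) ≤ b) :
    ∃ (k : ℕ) (x : Fin (k + 1) → C) (y : Fin (k + 1) → S),
      IsAugmentingPath E A b c k x y := by
  by_contra hno
  have hcn : A c = none := Option.eq_none_iff_forall_ne_some.2 fun s hs =>
    hc ((hA.1 c).2 ⟨s, hs⟩)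
  have hsat : ∀ i s, Reach E A c i s → b ≤ load A s := fun i s h => by
    by_contra! hs
    obtain ⟨k, -, x, y, hp⟩ := exists_isAugmentingPath_of_reach hcn h hs
    exact hno ⟨k, x, y, hp⟩
  set R : Finset S := Finset.univ.filter fun s => ∃ i, Reach E A c i s with hR
  -- Reachability is closed under alternating steps, so these more than `b * R.card` clients can
  -- only be served inside `R`.
  have hnb : neighbours E (insert c (clientsOf A R)) ⊆ R := fun s hs => by
    obtain ⟨d, hd, hds⟩ := mem_neighbours.1 hs
    rcases Finset.mem_insert.1 hd with rfl | hd
    · exact Finset.mem_filter.2 ⟨Finset.mem_univ _, 0, hds⟩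
    · obtain ⟨s', hs', hds'⟩ := mem_clientsOf.1 hd
      obtain ⟨i, hi⟩ := (Finset.mem_filter.1 hs').2
      exact Finset.mem_filter.2 ⟨Finset.mem_univ _, i + 1, s', d, hi, hds', hds⟩
  obtain ⟨B, hB, hBb⟩ := exists_isAssignment_maxLoad_eq_opt hE (insert c P)
  have hcR : c ∉ clientsOf A R := fun h => by
    obtain ⟨s, -, hs⟩ := mem_clientsOf.1 h
    simp [hcn] at hs
  have h1 := card_le_mul_card_neighbours hB (hBb.le.trans hb)
    (Finset.insert_subset_insert c (t := P) (s := clientsOf A R) fun d hd => by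
      obtain ⟨s, -, hs⟩ := mem_clientsOf.1 hd
      exact (hA.1 d).2 ⟨s, hs⟩)
  rw [Finset.card_insert_of_notMem hcR, card_clientsOf] at h1
  have h2 : b * R.card ≤ ∑ s ∈ R, load A s := by
    rw [mul_comm, ← smul_eq_mul]
    exact Finset.card_nsmul_le_sum _ _ _ fun s hs => by
      obtain ⟨i, hi⟩ := (Finset.mem_filter.1 hs).2
      exact hsat i s hi
  have h3 := Nat.mul_le_mul_left b (Finset.card_le_card hnb)
  omega

open Classical in
theorem IsAugmentation.isAssignment {P : Finset C} {k : ℕ} {x : Fin (k + 1) → C}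
    {y : Fin (k + 1) → S} (hA : IsAssignment E P A) (h : IsAugmentingPath E A b c k x y)
    (h' : IsAugmentation A A' k x y) : IsAssignment E (insert c P) A' := by
  refine ⟨fun d => ?_, fun d s hs => ?_⟩
  · by_cases hd : ∃ i, x i = d
    · obtain ⟨i, rfl⟩ := hd
      refine iff_of_true ?_ ⟨_, h'.1 i⟩
      refine Fin.cases ?_ (fun i => ?_) i
      · simp [h.start]
      · exact Finset.mem_insert_of_mem ((hA.1 _).2 ⟨_, h.assigned i⟩)
    · push Not at hd
      rw [h'.2 d hd, ← hA.1 d, Finset.mem_insert]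
      exact or_iff_right fun hdc => hd 0 (hdc ▸ h.start)
  · by_cases hd : ∃ i, x i = d
    · obtain ⟨i, rfl⟩ := hd
      rw [h'.1 i, Option.some.injEq] at hs
      exact hs ▸ h.edge i
    · push Not at hd
      exact hA.2 d s (h'.2 d hd ▸ hs)

/-- Each inner server of the path trades one client for another; only the last one gains, and it had
room. -/
theorem IsAugmentation.load_le {k : ℕ} {x : Fin (k + 1) → C}
    {y : Fin (k + 1) → S} (h : IsAugmentingPath E A b c k x y)
    (h' : IsAugmentation A A' k x y) (hb : ∀ s, load A s ≤ b) (s : S) : load A' s ≤ b := by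
  classical
  have key : ∀ d, A' d = some s → (∃ i, x i = d ∧ y i = s) ∨ (A d = some s ∧ ∀ i, x i ≠ d) := by
    intro d hd
    by_cases hdx : ∃ i, x i = d
    · obtain ⟨i, rfl⟩ := hdx
      rw [h'.1 i, Option.some.injEq] at hd
      exact Or.inl ⟨i, rfl, hd⟩
    · push Not at hdx
      exact Or.inr ⟨h'.2 d hdx ▸ hd, hdx⟩
  by_cases hs : ∃ i, y i = s
  · obtain ⟨i, rfl⟩ := hs
    induction i using Fin.lastCases with
    | last =>
      refine le_trans ?_ (Nat.succ_le_of_lt h.target)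
      rw [load_eq, load_eq]
      refine (Finset.card_le_card (t := insert (x (Fin.last k))
        (Finset.univ.filter fun d => A d = some (y (Fin.last k)))) fun d hd => ?_).trans
        (Finset.card_insert_le _ _)
      rcases key d (by simpa using hd) with ⟨i, rfl, hi⟩ | ⟨hd, -⟩
      · simp [h.server_injective hi]
      · simp [hd]
    | cast i =>
      refine le_trans ?_ (hb (y i.castSucc))
      have hmem : x i.succ ∈ Finset.univ.filter fun d => A d = some (y i.castSucc) := by
        simpa using h.assigned i
      rw [load_eq, load_eq, ← Finset.card_erase_add_one hmem]
      refine (Finset.card_le_card (t := insert (x i.castSucc) ((Finset.univ.filter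
        fun d => A d = some (y i.castSucc)).erase (x i.succ))) fun d hd => ?_).trans
        (Finset.card_insert_le _ _)
      rcases key d (by simpa using hd) with ⟨j, rfl, hj⟩ | ⟨hd, hx⟩
      · simp [h.server_injective hj]
      · simp [hd, (hx i.succ).symm]
  · refine le_trans ?_ (hb s)
    rw [load_eq, load_eq]
    refine Finset.card_le_card fun d hd => ?_
    rcases key d (by simpa using hd) with ⟨j, rfl, hj⟩ | ⟨hd, -⟩
    · exact absurd ⟨j, hj⟩ hs
    · simpa using hd

open Classical in
theorem load_update_le (A : C → Option S) (c : C) (s s' : S) :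
    load (Function.update A c (some s)) s' ≤ load A s' + 1 := by
  rw [load_eq, load_eq]
  refine (Finset.card_le_card (t := insert c (Finset.univ.filter fun d => A d = some s'))
    fun d hd => ?_).trans (Finset.card_insert_le _ _)
  by_cases hdc : d = c
  · simp [hdc]
  · simpa [hdc] using hd

open Classical in
/-- What one step of SAP does: either no earlier client is reassigned, or the optimum is unchanged
and the number `r` of reassigned clients is such that all servers within alternating distance less
than `r` are saturated. -/
theorem SAPStep.spec [Fintype S] {P P' : Finset C} (hE : ∀ c, ∃ s, E c s)
    (hA : IsAssignment E P A) (hAP : maxLoad A = opt E P) (hc : c ∉ P)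
    (hP' : ∀ d, d ∈ P' ↔ d = c ∨ d ∈ P) (h : SAPStep E P c A A') :
    IsAssignment E P' A' ∧ maxLoad A' = opt E P' ∧
      ((P.filter fun d => A' d ≠ A d).card = 0 ∨
        (opt E P = opt E P' ∧ 0 < opt E P' ∧
          (P.filter fun d => A' d ≠ A d).card * opt E P' ≤ Fintype.card C ∧
          ∀ i < (P.filter fun d => A' d ≠ A d).card, ∀ s, Reach E A c i s →
            opt E P' ≤ load A s)) := by
  obtain rfl : P' = insert c P := by ext d; simp [hP' d]
  have hcn : A c = none := Option.eq_none_iff_forall_ne_some.2 fun s hs =>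
    hc ((hA.1 c).2 ⟨s, hs⟩)
  unfold SAPStep at h
  by_cases hlt : opt E P < opt E (insert c P)
  · rw [if_pos hlt] at h
    obtain ⟨s, hs, rfl⟩ := h
    have hA' : IsAssignment E (insert c P) (Function.update A c (some s)) := by
      refine ⟨fun d => ?_, fun d s' hd => ?_⟩
      · by_cases hdc : d = c
        · simp [hdc]
        · simpa [hdc] using hA.1 d
      · by_cases hdc : d = c
        · subst hdc
          simp only [Function.update_self, Option.some.injEq] at hd
          exact hd ▸ hs
        · exact hA.2 d s' (by simpa [hdc] using hd)
    refine ⟨hA', le_antisymm (maxLoad_le fun s' => ?_) (opt_le_maxLoad hA'), Or.inl ?_⟩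
    -- The optimum has risen by at least one, which pays for the one extra client.
    · have := load_update_le A c s s'
      have := load_le_maxLoad A s'
      omega
    · rw [Finset.card_eq_zero, Finset.filter_eq_empty_iff]
      intro d hd
      have : d ≠ c := fun hdc => hc (hdc ▸ hd)
      simp [this]
  · have heq : opt E P = opt E (insert c P) :=
      le_antisymm (opt_mono hE (Finset.subset_insert c P)) (not_lt.1 hlt)
    rw [if_neg hlt, if_pos (exists_isAugmentingPath hE hA hc le_rfl)] at h
    obtain ⟨k, x, y, hp, hmin, haug⟩ := h
    have hA' := IsAugmentation.isAssignment hA hp haug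
    refine ⟨hA', le_antisymm (maxLoad_le <| haug.load_le hp fun s => ?_) (opt_le_maxLoad hA'),
      Or.inr ⟨heq, (Nat.zero_le _).trans_lt hp.target, ?_⟩⟩
    · rw [← heq, ← hAP]
      exact load_le_maxLoad A s
    -- Of the `k + 1` clients on the path, the first is new and does not count as reassigned.
    have hr : (P.filter fun d => A' d ≠ A d).card ≤ k := by
      refine (Finset.card_le_card (t := Finset.univ.image fun i : Fin k => x i.succ)
        fun d hd => ?_).trans (Finset.card_image_le.trans (by simp))
      obtain ⟨hdP, hd⟩ := Finset.mem_filter.1 hd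
      by_cases hdx : ∃ i, x i = d
      · obtain ⟨i, rfl⟩ := hdx
        induction i using Fin.cases with
        | zero => exact absurd (hp.start ▸ hdP) hc
        | succ i => simp
      · push Not at hdx
        exact absurd (haug.2 d hdx) hd
    have hsat : ∀ i < k, ∀ s, Reach E A c i s → opt E (insert c P) ≤ load A s := by
      intro i hi s hs
      by_contra! hlt'
      obtain ⟨k', hk', x', y', hp'⟩ := exists_isAugmentingPath_of_reach hcn hs hlt'
      have := hmin k' x' y' hp'
      omega
    refine ⟨(Nat.mul_le_mul_right _ hr).trans ?_, fun i hi => hsat i (hi.trans_le hr)⟩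
    -- The first `k` servers of the path are distinct and saturated, so they hold at least `k` times
    -- the optimum many clients.
    have h1 := card_clientsOf A (Finset.univ.image fun i : Fin k => y i.castSucc)
    rw [Finset.sum_image fun i _ j _ hij =>
      Fin.castSucc_injective k (hp.server_injective hij)] at h1
    calc k * opt E (insert c P) = ∑ i : Fin k, opt E (insert c P) := by simp
      _ ≤ ∑ i : Fin k, load A (y i.castSucc) := Finset.sum_le_sum fun i _ =>
          hsat i i.2 _ (by simpa using hp.reach i.castSucc)
      _ ≤ Fintype.card C := h1 ▸ Finset.card_le_univ _

end Augmentation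

/-! ### The excess as a potential -/

section Excess

variable {C S : Type*} [Fintype S] {E : C → S → Prop}

/-- The maximum of `|K| - lam * |N(K)|` over all sets `K` of clients in `P`. -/
noncomputable def excess (E : C → S → Prop) (lam : ℝ) (P : Finset C) : ℝ :=
  P.powerset.sup' ⟨∅, Finset.empty_mem_powerset P⟩
    fun K => (K.card : ℝ) - lam * (neighbours E K).card

theorem le_excess (E : C → S → Prop) (lam : ℝ) {P K : Finset C} (h : K ⊆ P) :
    (K.card : ℝ) - lam * (neighbours E K).card ≤ excess E lam P :=
  Finset.le_sup' (fun K : Finset C => (K.card : ℝ) - lam * (neighbours E K).card)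
    (Finset.mem_powerset.2 h)

theorem exists_eq_excess (E : C → S → Prop) (lam : ℝ) (P : Finset C) :
    ∃ K ⊆ P, excess E lam P = (K.card : ℝ) - lam * (neighbours E K).card := by
  obtain ⟨K, hK, h⟩ := Finset.exists_mem_eq_sup' (s := P.powerset)
    ⟨∅, Finset.empty_mem_powerset P⟩
    fun K => (K.card : ℝ) - lam * (neighbours E K).card
  exact ⟨K, Finset.mem_powerset.1 hK, h⟩

theorem excess_nonneg (E : C → S → Prop) (lam : ℝ) (P : Finset C) : 0 ≤ excess E lam P := by
  simpa [neighbours] using le_excess E lam (Finset.empty_subset P)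

theorem excess_mono (E : C → S → Prop) (lam : ℝ) {P Q : Finset C} (h : P ⊆ Q) :
    excess E lam P ≤ excess E lam Q := by
  obtain ⟨K, hK, heq⟩ := exists_eq_excess E lam P
  exact heq ▸ le_excess E lam (hK.trans h)

/-- By Hall's condition `K.card ≤ b * (neighbours E K).card`, so at most the fraction `δ` of `K` is
left over. -/
theorem excess_le [Fintype C] {P : Finset C} {A : C → Option S} {b : ℕ} {δ : ℝ}
    (hA : IsAssignment E P A) (hb : maxLoad A ≤ b) (h0 : 0 ≤ δ) (h1 : δ ≤ 1) :
    excess E ((1 - δ) * b) P ≤ δ * Fintype.card C := by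
  obtain ⟨K, hK, heq⟩ := exists_eq_excess E ((1 - δ) * b) P
  have h2 : (K.card : ℝ) ≤ b * (neighbours E K).card := by
    exact_mod_cast card_le_mul_card_neighbours hA hb hK
  have h3 : (K.card : ℝ) ≤ Fintype.card C := by exact_mod_cast Finset.card_le_univ K
  have h4 := mul_le_mul_of_nonneg_left h2 (sub_nonneg.2 h1)
  have h5 := mul_le_mul_of_nonneg_left h3 h0
  rw [heq]
  linarith

open Classical in
/-- If all servers within alternating distance less than `k + 1` of the new client are saturated,
and there are not enough clients for `k` expansions by the factor `(1 - δ)⁻¹`, then the insertion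
increases the excess by one. -/
theorem excess_add_one_le [Fintype C] {P P' : Finset C} {A : C → Option S} {b k : ℕ} {δ : ℝ}
    {c : C} (hA : IsAssignment E P A) (hc : c ∉ P) (hP' : ∀ d, d ∈ P' ↔ d = c ∨ d ∈ P)
    (hb : 0 < b) (hδ : δ ≤ 1)
    (hsat : ∀ i < k + 1, ∀ s, Reach E A c i s → b ≤ load A s)
    (hk : (1 - δ) ^ k * Fintype.card C < 1) :
    excess E ((1 - δ) * b) P + 1 ≤ excess E ((1 - δ) * b) P' := by
  obtain ⟨K, hK, heq⟩ := exists_eq_excess E ((1 - δ) * b) P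
  have hb' : (0 : ℝ) < b := by exact_mod_cast hb
  by_cases hN : ∀ s, E c s → s ∈ neighbours E K
  · have h1 : neighbours E (insert c K) = neighbours E K := by
      ext s
      constructor
      · intro hs
        obtain ⟨d, hd, hds⟩ := mem_neighbours.1 hs
        rcases Finset.mem_insert.1 hd with rfl | hd
        · exact hN s hds
        · exact mem_neighbours.2 ⟨d, hd, hds⟩
      · intro hs
        obtain ⟨d, hd, hds⟩ := mem_neighbours.1 hs
        exact mem_neighbours.2 ⟨d, Finset.mem_insert_of_mem hd, hds⟩
    have h2 := le_excess E ((1 - δ) * b) (P := P') (K := insert c K) fun d hd =>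
      (hP' d).2 ((Finset.mem_insert.1 hd).imp_right fun h => hK h)
    rw [h1, Finset.card_insert_of_notMem fun h => hc (hK h)] at h2
    push_cast at h2
    linarith
  · exfalso
    push Not at hN
    obtain ⟨s₀, hcs, hs₀⟩ := hN
    -- Layers of the alternating search from `s₀`, with the servers in `neighbours E K` deleted.
    let T : ℕ → Finset S := fun i =>
      Nat.rec {s₀} (fun _ T => neighbours E (clientsOf A T) \ neighbours E K) i
    have hT : ∀ i, T (i + 1) = neighbours E (clientsOf A (T i)) \ neighbours E K := fun i => rfl
    have hreach : ∀ i, ∀ s ∈ T i, Reach E A c i s := by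
      intro i
      induction i with
      | zero =>
        intro s hs
        rw [Finset.mem_singleton.1 hs]
        exact hcs
      | succ i ih =>
        intro s hs
        rw [hT] at hs
        obtain ⟨d, hd, hds⟩ := mem_neighbours.1 (Finset.mem_sdiff.1 hs).1
        obtain ⟨s', hs', hds'⟩ := mem_clientsOf.1 hd
        exact ⟨s', d, ih s' hs', hds', hds⟩
    have hout : ∀ i, ∀ s ∈ T i, s ∉ neighbours E K := by
      intro i s hs
      rcases i with _ | i
      · rwa [Finset.mem_singleton.1 hs]
      · exact (Finset.mem_sdiff.1 (hT i ▸ hs)).2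
    have hcard : ∀ i < k + 1, (b : ℝ) * (T i).card ≤ (clientsOf A (T i)).card := by
      intro i hi
      rw [card_clientsOf]
      have := Finset.card_nsmul_le_sum (T i) (load A) b fun s hs =>
        hsat i hi s (hreach i s hs)
      rw [smul_eq_mul, mul_comm] at this
      exact_mod_cast this
    have hexp : ∀ i < k + 1, ((T i).card : ℝ) ≤ (1 - δ) * (T (i + 1)).card := by
      intro i hi
      have hdisj : Disjoint K (clientsOf A (T i)) := by
        refine Finset.disjoint_left.2 fun d hd hd' => ?_
        obtain ⟨s, hs, hds⟩ := mem_clientsOf.1 hd'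
        exact hout i s hs (mem_neighbours.2 ⟨d, hd, hA.2 d s hds⟩)
      -- Adding the clients of a layer to the maximiser `K` gains at least `b * (T i).card` clients
      -- and costs `(1 - δ) * b` for each server in the next layer. Maximality forbids a net gain.
      have h1 := le_excess E ((1 - δ) * b) (P := P) (K := K ∪ clientsOf A (T i))
        (Finset.union_subset hK fun d hd => by
          obtain ⟨s, -, hs⟩ := mem_clientsOf.1 hd
          exact (hA.1 d).2 ⟨s, hs⟩)
      have h2 : neighbours E (K ∪ clientsOf A (T i)) = neighbours E K ∪ T (i + 1) := by
        rw [hT, Finset.union_sdiff_self_eq_union]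
        ext s
        simp only [mem_neighbours, Finset.mem_union, or_and_right, exists_or]
      have h3 : Disjoint (neighbours E K) (T (i + 1)) := by
        rw [hT]
        exact Finset.disjoint_sdiff
      rw [heq, h2, Finset.card_union_of_disjoint h3, Finset.card_union_of_disjoint hdisj] at h1
      push_cast at h1
      have h4 := hcard i hi
      refine le_of_mul_le_mul_left ?_ hb'
      linarith
    have hpow : ∀ i < k + 1, (1 : ℝ) ≤ (1 - δ) ^ i * (T i).card := by
      intro i
      induction i with
      | zero =>
        intro _
        simp [T]
      | succ i ih =>
        intro hi
        refine (ih (by omega)).trans ?_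
        rw [pow_succ, mul_assoc]
        exact mul_le_mul_of_nonneg_left (hexp i (by omega)) (pow_nonneg (sub_nonneg.2 hδ) i)
    have h1 : ((T k).card : ℝ) ≤ Fintype.card C := by
      have h2 := hcard k (by omega)
      have h3 : ((clientsOf A (T k)).card : ℝ) ≤ Fintype.card C := by
        exact_mod_cast Finset.card_le_univ _
      have h4 : (1 : ℝ) * (T k).card ≤ b * (T k).card :=
        mul_le_mul_of_nonneg_right (by exact_mod_cast hb) (Nat.cast_nonneg _)
      linarith
    have h2 := mul_le_mul_of_nonneg_left h1 (pow_nonneg (sub_nonneg.2 hδ) k)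
    linarith [hpow k (by omega)]

end Excess


/-! ### Counting the insertions with many reassignments -/

section Run

variable {n : ℕ} {S : Type*} [Fintype S] {E : Fin n → S → Prop}
  {A : Fin (n + 1) → Fin n → Option S}

theorem mem_arrived {n t : ℕ} {i : Fin n} : i ∈ arrived n t ↔ i.val < t := by
  simp [arrived]

theorem arrived_mono {n t u : ℕ} (h : t ≤ u) : arrived n t ⊆ arrived n u := fun _ hi =>
  mem_arrived.2 ((mem_arrived.1 hi).trans_le h)

theorem mem_arrived_succ {n : ℕ} {t i : Fin n} :
    i ∈ arrived n (t.val + 1) ↔ i = t ∨ i ∈ arrived n t.val := by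
  rw [mem_arrived, mem_arrived, Fin.ext_iff]
  omega

open Classical in
/-- The number of reassignments during the insertion of the client `t`. -/
noncomputable def reassignments (A : Fin (n + 1) → Fin n → Option S) (t : Fin n) : ℕ :=
  ((arrived n t.val).filter fun d => A t.succ d ≠ A t.castSucc d).card

omit [Fintype S] in
theorem totalReassignments_eq (A : Fin (n + 1) → Fin n → Option S) :
    totalReassignments A = ∑ t, reassignments A t :=
  rfl

omit [Fintype S] in
theorem reassignments_le (A : Fin (n + 1) → Fin n → Option S) (t : Fin n) :
    reassignments A t ≤ t.val := by
  classical
  calc reassignments A t ≤ (arrived n t.val).card := Finset.card_filter_le _ _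
    _ ≤ (Finset.range t.val).card := Finset.card_le_card_of_injOn Fin.val
        (fun i hi => by simpa using mem_arrived.1 hi) Fin.val_injective.injOn
    _ = t.val := Finset.card_range _

theorem IsSAPRun.isAssignment (hE : ∀ c, ∃ s, E c s) (h : IsSAPRun E A) (t : Fin (n + 1)) :
    IsAssignment E (arrived n t.val) (A t) ∧ maxLoad (A t) = opt E (arrived n t.val) := by
  induction t using Fin.induction with
  | zero =>
    have h0 : IsAssignment E (arrived n (0 : Fin (n + 1)).val) (A 0) :=
      ⟨fun c => by simp [mem_arrived, h.1 c], fun c s hs => by simp [h.1 c] at hs⟩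
    refine ⟨h0, le_antisymm (maxLoad_le fun s => ?_) (opt_le_maxLoad h0)⟩
    simp [load, h.1]
  | succ t ih =>
    have := (h.2 t).spec hE ih.1 ih.2 (by simp [mem_arrived]) fun d => mem_arrived_succ
    exact ⟨this.1, this.2.1⟩

theorem IsSAPRun.reassignments_spec (hE : ∀ c, ∃ s, E c s) (h : IsSAPRun E A) (t : Fin n)
    (ht : reassignments A t ≠ 0) :
    opt E (arrived n t.val) = opt E (arrived n (t.val + 1)) ∧
      0 < opt E (arrived n (t.val + 1)) ∧
      reassignments A t * opt E (arrived n (t.val + 1)) ≤ n ∧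
      ∀ i < reassignments A t, ∀ s, Reach E (A t.castSucc) t i s →
        opt E (arrived n (t.val + 1)) ≤ load (A t.castSucc) s := by
  have ih := h.isAssignment hE t.castSucc
  have := ((h.2 t).spec hE ih.1 ih.2 (by simp [mem_arrived])
    fun d => mem_arrived_succ).2.2.resolve_left ht
  rwa [Fintype.card_fin] at this

/-- While the optimum is `b`, at most `n * log n / h` insertions cause more than `h`
reassignments. -/
theorem IsSAPRun.card_long_le (hE : ∀ c, ∃ s, E c s) (h : IsSAPRun E A) (hn : 2 ≤ n)
    (b : ℕ) {k : ℕ} (hk : 1 ≤ k) :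
    ((Finset.univ.filter fun t : Fin n =>
      opt E (arrived n (t.val + 1)) = b ∧ k < reassignments A t).card : ℝ) ≤
      Real.log n / k * n := by
  set δ : ℝ := Real.log n / k with hδ
  have hn' : (0 : ℝ) < n := by exact_mod_cast (by omega : 0 < n)
  have hk' : (0 : ℝ) < k := by exact_mod_cast hk
  have hlog : 0 < Real.log n := Real.log_pos (by exact_mod_cast hn)
  have hδ0 : 0 < δ := div_pos hlog hk'
  rcases le_or_gt 1 δ with hδ1 | hδ1
  -- Here the bound is at least `n`, the number of all insertions.
  · refine le_trans ?_ (le_mul_of_one_le_left hn'.le hδ1)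
    exact_mod_cast (Finset.card_le_univ _).trans (Fintype.card_fin n).le
  have hpow : (1 - δ) ^ k * (n : ℝ) < 1 := by
    have h1 : (1 - δ) ^ k < Real.exp (-δ) ^ k := by
      refine pow_lt_pow_left₀ ?_ (by linarith) (by omega)
      have := Real.add_one_lt_exp (neg_ne_zero.2 hδ0.ne')
      linarith
    rw [← Real.exp_nat_mul, hδ, show (k : ℝ) * -(Real.log n / k) = -Real.log n by field_simp,
      Real.exp_neg, Real.exp_log hn'] at h1
    calc (1 - δ) ^ k * (n : ℝ) < (n : ℝ)⁻¹ * n := mul_lt_mul_of_pos_right h1 hn'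
      _ = 1 := inv_mul_cancel₀ hn'.ne'
  -- The excess for this fixed `b` starts nonnegative, grows by one at each counted insertion and
  -- never drops at the others.
  have key : ∀ j ≤ n, ((Finset.univ.filter fun t : Fin n => t.val < j ∧
      opt E (arrived n (t.val + 1)) = b ∧ k < reassignments A t).card : ℝ) ≤
      excess E ((1 - δ) * b) (arrived n j) := by
    intro j
    induction j with
    | zero =>
      intro _
      simpa using excess_nonneg _ _ _
    | succ j ih =>
      intro hj
      have ih := ih (by omega)
      let t : Fin n := ⟨j, hj⟩
      by_cases ht : opt E (arrived n (j + 1)) = b ∧ k < reassignments A t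
      · have hs := h.reassignments_spec hE t (by omega)
        have hA := h.isAssignment hE t.castSucc
        have h1 := excess_add_one_le (P' := arrived n (j + 1)) (δ := δ) (k := k) (b := b) hA.1
          (c := t) (by simp [mem_arrived]) (fun d => mem_arrived_succ (t := t))
          (ht.1 ▸ hs.2.1) hδ1.le (fun i hi s hi' => ht.1 ▸ hs.2.2.2 i (by omega) s hi')
          (by rwa [Fintype.card_fin])
        refine le_trans ?_ h1
        refine le_trans ?_ (add_le_add_left ih 1)
        have h2 : (Finset.univ.filter fun t : Fin n => t.val < j + 1 ∧
            opt E (arrived n (t.val + 1)) = b ∧ k < reassignments A t) ⊆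
            insert t (Finset.univ.filter fun t : Fin n => t.val < j ∧
              opt E (arrived n (t.val + 1)) = b ∧ k < reassignments A t) := by
          intro u hu
          simp only [Finset.mem_filter, Finset.mem_univ, true_and, Finset.mem_insert,
            Fin.ext_iff, t] at hu ⊢
          by_cases hut : u.val = j
          · exact Or.inl hut
          · exact Or.inr ⟨by omega, hu.2⟩
        exact_mod_cast (Finset.card_le_card h2).trans (Finset.card_insert_le _ _)
      · refine le_trans ?_ (ih.trans (excess_mono _ _ (arrived_mono (Nat.le_succ j))))
        refine Nat.cast_le.2 (Finset.card_le_card fun u hu => ?_)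
        simp only [Finset.mem_filter, Finset.mem_univ, true_and] at hu ⊢
        refine ⟨lt_of_le_of_ne (by omega) fun huj => ht ?_, hu.2⟩
        have hut : u = t := Fin.ext huj
        rw [← hut, ← huj]
        exact hu.2
  rcases Finset.eq_empty_or_nonempty (Finset.univ.filter fun t : Fin n =>
      opt E (arrived n (t.val + 1)) = b ∧ k < reassignments A t) with h0 | hne
  · rw [h0]
    simpa using mul_nonneg hδ0.le hn'.le
  -- The excess is compared with `δ * n` just after the last counted insertion, when the optimum is
  -- still `b`.
  · obtain ⟨t, ht, hmax⟩ := Finset.exists_max_image _ (fun t : Fin n => t.val) hne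
    have hA := h.isAssignment hE t.succ
    have htb := (Finset.mem_filter.1 ht).2.1
    have h1 := excess_le hA.1 (hA.2.trans htb).le hδ0.le hδ1.le
    rw [Fintype.card_fin] at h1
    refine le_trans ?_ ((key (t.val + 1) t.2).trans h1)
    refine Nat.cast_le.2 (Finset.card_le_card fun u hu => ?_)
    have := hmax u hu
    simp only [Finset.mem_filter, Finset.mem_univ, true_and] at hu ⊢
    exact ⟨by omega, hu⟩

/-- Group the insertions by the current optimum `b`. Saturation along the path forces `k * b ≤ n`,
which limits the number of groups. -/
theorem IsSAPRun.card_lt_reassignments_le (hE : ∀ c, ∃ s, E c s) (h : IsSAPRun E A)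
    (hn : 2 ≤ n) {k : ℕ} (hk : 1 ≤ k) :
    ((Finset.univ.filter fun t : Fin n => k < reassignments A t).card : ℝ) ≤
      (min (opt E Finset.univ) (n / k) : ℕ) * (Real.log n / k * n) := by
  have hmaps : ((Finset.univ.filter fun t : Fin n => k < reassignments A t : Finset (Fin n)) :
      Set (Fin n)).MapsTo (fun t : Fin n => opt E (arrived n (t.val + 1)))
      (Finset.Icc 1 (min (opt E Finset.univ) (n / k)) : Finset ℕ) := by
    intro t ht
    have ht : k < reassignments A t := by simpa using ht
    obtain ⟨-, hpos, hle, -⟩ := h.reassignments_spec hE t (by omega)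
    simp only [Finset.coe_Icc, Set.mem_Icc, le_min_iff]
    refine ⟨hpos, opt_mono hE (Finset.subset_univ _), (Nat.le_div_iff_mul_le hk).2 ?_⟩
    calc _ = k * opt E (arrived n (t.val + 1)) := mul_comm _ _
      _ ≤ reassignments A t * opt E (arrived n (t.val + 1)) := Nat.mul_le_mul_right _ ht.le
      _ ≤ n := hle
  rw [Finset.card_eq_sum_card_fiberwise hmaps]
  push_cast
  refine (Finset.sum_le_card_nsmul _ _ (Real.log n / k * n) fun b _ => ?_).trans (le_of_eq ?_)
  · refine le_trans (Nat.cast_le.2 (Finset.card_le_card fun t ht => ?_))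
      (h.card_long_le hE hn b hk)
    simp only [Finset.mem_filter, Finset.mem_univ, true_and] at ht ⊢
    exact ⟨ht.2, ht.1⟩
  · rw [Nat.card_Icc, nsmul_eq_mul]
    push_cast [Nat.add_sub_cancel]
    rfl

end Run

/-! ### Summation over the number of reassignments -/

theorem sum_le_mul_add_sum_card {ι : Type*} [Fintype ι] (r : ι → ℕ) (m : ℕ) {N : ℕ}
    (hr : ∀ i, r i ≤ N) :
    ∑ i, r i ≤ Fintype.card ι * m +
      ∑ k ∈ Finset.Ico m N, (Finset.univ.filter fun i => k < r i).card := by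
  simp only [Finset.card_filter]
  rw [Finset.sum_comm]
  calc ∑ i, r i ≤ ∑ i, (m + ∑ k ∈ Finset.Ico m N, if k < r i then 1 else 0) := by
        refine Finset.sum_le_sum fun i _ => ?_
        rw [← Finset.card_filter]
        -- Layer cake: the part of `r i` above `m` is the number of `k ≥ m` below `r i`.
        have : Finset.Ico m (r i) ⊆ (Finset.Ico m N).filter fun k => k < r i := by
          intro k hk
          have := hr i
          simp only [Finset.mem_filter, Finset.mem_Ico] at hk ⊢
          omega
        have := Finset.card_le_card this
        rw [Nat.card_Ico] at this
        omega
    _ = _ := by simp [Finset.sum_add_distrib]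

theorem half_le_log {n : ℕ} (hn : 2 ≤ n) : (1 / 2 : ℝ) ≤ Real.log n := by
  have h1 := Real.log_two_gt_d9
  have h2 : Real.log 2 ≤ Real.log n := Real.log_le_log two_pos (by exact_mod_cast hn)
  linarith

section Bounds

variable {n : ℕ} {S : Type*} [Fintype S] {E : Fin n → S → Prop}
  {A : Fin (n + 1) → Fin n → Option S}

theorem IsSAPRun.totalReassignments_le (hE : ∀ c, ∃ s, E c s) (h : IsSAPRun E A)
    (hn : 2 ≤ n) {m : ℕ} (hm : 1 ≤ m) :
    (totalReassignments A : ℝ) ≤ n * m + ∑ k ∈ Finset.Ico m n,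
      (min (opt E Finset.univ) (n / k) : ℕ) * (Real.log n / k * n) := by
  have h1 := sum_le_mul_add_sum_card (reassignments A) m (N := n) fun t =>
    (reassignments_le A t).trans t.2.le
  rw [← totalReassignments_eq, Fintype.card_fin] at h1
  refine (Nat.cast_le (α := ℝ).2 h1).trans ?_
  push_cast
  refine add_le_add le_rfl (Finset.sum_le_sum fun k hk => ?_)
  simpa using h.card_lt_reassignments_le hE hn (hm.trans (Finset.mem_Ico.1 hk).1)

theorem one_le_opt_univ (hE : ∀ c, ∃ s, E c s) (hn : 0 < n) : 1 ≤ opt E Finset.univ := by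
  obtain ⟨B, hB, hBo⟩ := exists_isAssignment_maxLoad_eq_opt hE Finset.univ
  have := card_le_mul_card_neighbours hB hBo.le (Finset.Subset.refl _)
  rw [Finset.card_univ, Fintype.card_fin] at this
  by_contra! h0
  obtain h0 : opt E Finset.univ = 0 := by omega
  rw [h0] at this
  omega

theorem IsSAPRun.totalReassignments_le_opt_mul (hE : ∀ c, ∃ s, E c s) (h : IsSAPRun E A)
    (hn : 2 ≤ n) :
    (totalReassignments A : ℝ) ≤
      10 * (n * ((opt E Finset.univ : ℝ) * Real.log n ^ 2)) := by
  have hlog := half_le_log hn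
  have hL : (1 : ℝ) ≤ opt E Finset.univ := by exact_mod_cast one_le_opt_univ hE (by omega)
  set L : ℝ := ((opt E Finset.univ : ℕ) : ℝ)
  have hsum : ∑ k ∈ Finset.Ico 1 n, ((k : ℝ))⁻¹ ≤ 1 + Real.log n := by
    have h1 := harmonic_le_one_add_log n
    rw [harmonic_eq_sum_Icc] at h1
    push_cast at h1
    refine le_trans (Finset.sum_le_sum_of_subset_of_nonneg (fun k hk => ?_)
      fun k _ _ => by positivity) h1
    simp only [Finset.mem_Ico, Finset.mem_Icc] at hk ⊢
    omega
  have hX : 0 ≤ L * Real.log n * n := by positivity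
  calc (totalReassignments A : ℝ) ≤ n * (1 : ℕ) + ∑ k ∈ Finset.Ico 1 n,
        (min (opt E Finset.univ) (n / k) : ℕ) * (Real.log n / k * n) :=
        h.totalReassignments_le hE hn le_rfl
    _ ≤ n + ∑ k ∈ Finset.Ico 1 n, L * Real.log n * n * (k : ℝ)⁻¹ := by
        refine add_le_add (by simp) (Finset.sum_le_sum fun k _ => ?_)
        calc (min (opt E Finset.univ) (n / k) : ℕ) * (Real.log n / k * n)
            ≤ L * (Real.log n / k * n) :=
              mul_le_mul_of_nonneg_right (Nat.cast_le.2 (min_le_left _ _)) (by positivity)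
          _ = _ := by ring
    _ ≤ n + L * Real.log n * n * (1 + Real.log n) := by
        rw [← Finset.mul_sum]
        exact add_le_add le_rfl (mul_le_mul_of_nonneg_left hsum hX)
    _ ≤ 10 * (n * (L * Real.log n ^ 2)) := by
        -- As `log n ≥ 1/2`, the three terms cost at most 4, 2 and 1 times the target, so 10 is
        -- generous.
        have h1 : 1 ≤ 4 * Real.log n ^ 2 := by nlinarith
        have h2 : (n : ℝ) ≤ n * (L * (4 * Real.log n ^ 2)) :=
          le_mul_of_one_le_right (by positivity) (one_le_mul_of_one_le_of_one_le hL h1)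
        have h3 : L * Real.log n * n * 1 ≤ L * Real.log n * n * (2 * Real.log n) :=
          mul_le_mul_of_nonneg_left (by linarith) hX
        have h4 : 0 ≤ n * (L * Real.log n ^ 2) := by positivity
        linarith

theorem IsSAPRun.totalReassignments_le_sqrt_mul (hE : ∀ c, ∃ s, E c s) (h : IsSAPRun E A)
    (hn : 2 ≤ n) :
    (totalReassignments A : ℝ) ≤ 10 * (n * (√n * Real.log n)) := by
  have hlog := half_le_log hn
  have hn1 : (1 : ℝ) ≤ n := by exact_mod_cast (by omega : 1 ≤ n)
  have hsq : (1 : ℝ) ≤ √n := Real.one_le_sqrt.2 hn1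
  -- This threshold balances `n * m` against the tail, of order `n ^ 2 / m`, up to the logarithm.
  set m : ℕ := ⌈√(n : ℝ)⌉₊
  have hm1 : √(n : ℝ) ≤ m := Nat.le_ceil _
  have hm2 : (m : ℝ) ≤ 2 * √n := by
    have := Nat.ceil_lt_add_one (Real.sqrt_nonneg (n : ℝ))
    linarith
  have hm : 1 ≤ m := by exact_mod_cast hsq.trans hm1
  have hsum : ∑ k ∈ Finset.Ico m n, ((k : ℝ) ^ 2)⁻¹ ≤ 2 / √n := by
    have h1 := sum_Ioo_inv_sq_le (α := ℝ) (m - 1) n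
    rw [Nat.cast_sub hm, Nat.cast_one, sub_add_cancel] at h1
    rw [show Finset.Ico m n = Finset.Ioo (m - 1) n by
      ext k
      simp only [Finset.mem_Ico, Finset.mem_Ioo]
      omega]
    exact h1.trans (div_le_div_of_nonneg_left two_pos.le (by positivity) hm1)
  calc (totalReassignments A : ℝ) ≤ n * m + ∑ k ∈ Finset.Ico m n,
        (min (opt E Finset.univ) (n / k) : ℕ) * (Real.log n / k * n) :=
        h.totalReassignments_le hE hn hm
    _ ≤ n * m + ∑ k ∈ Finset.Ico m n, Real.log n * n ^ 2 * ((k : ℝ) ^ 2)⁻¹ := by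
        refine add_le_add le_rfl (Finset.sum_le_sum fun k _ => ?_)
        calc (min (opt E Finset.univ) (n / k) : ℕ) * (Real.log n / k * n)
            ≤ (n / k : ℝ) * (Real.log n / k * n) :=
              mul_le_mul_of_nonneg_right ((Nat.cast_le.2 (min_le_right _ _)).trans Nat.cast_div_le)
                (by positivity)
          _ = _ := by ring
    _ ≤ n * (2 * √n) + Real.log n * n ^ 2 * (2 / √n) := by
        rw [← Finset.mul_sum]
        gcongr
    _ = 2 * (n * √n) + 2 * (n * (√n * Real.log n)) := by
        have h1 : (n : ℝ) / √n = √n := Real.div_sqrt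
        rw [show Real.log n * n ^ 2 * (2 / √n) = 2 * (n * (n / √n * Real.log n)) by ring, h1]
        ring
    _ ≤ 10 * (n * (√n * Real.log n)) := by
        have h1 : n * √n * 1 ≤ n * √n * (2 * Real.log n) :=
          mul_le_mul_of_nonneg_left (by linarith) (by positivity)
        have h2 : 0 ≤ n * (√n * Real.log n) := by positivity
        linarith

end Bounds

end OnlineAssignment

theorem theorem5 :
    ∃ K : ℝ, 0 < K ∧
      ∀ (n : ℕ) (S : Type*) [Fintype S] (E : Fin n → S → Prop)
        (A : Fin (n + 1) → Fin n → Option S),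
        (∀ c, ∃ s, E c s) →
        OnlineAssignment.IsSAPRun E A →
        (∀ t : Fin (n + 1),
          OnlineAssignment.IsAssignment E (OnlineAssignment.arrived n t.val) (A t) ∧
          OnlineAssignment.maxLoad (A t) =
            OnlineAssignment.opt E (OnlineAssignment.arrived n t.val)) ∧
        (OnlineAssignment.totalReassignments A : ℝ) ≤
          K * (n * min ((OnlineAssignment.opt E Finset.univ : ℝ) * Real.log n ^ 2)
            (√n * Real.log n)) := by
  refine ⟨10, by norm_num, fun n S _ E A hE h => ⟨h.isAssignment hE, ?_⟩⟩
  rcases lt_or_ge n 2 with hn | hn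
  -- Here `Real.log n = 0`, so the claimed bound is zero; no client has an earlier one to displace.
  · have h0 : OnlineAssignment.totalReassignments A = 0 := by
      rw [OnlineAssignment.totalReassignments_eq]
      refine Finset.sum_eq_zero fun t _ => ?_
      have := OnlineAssignment.reassignments_le A t
      omega
    have hlog : 0 ≤ Real.log n := Real.log_natCast_nonneg n
    rw [h0, Nat.cast_zero]
    positivity
  · have hn0 : (0 : ℝ) ≤ n := Nat.cast_nonneg n
    rw [mul_min_of_nonneg _ _ hn0, mul_min_of_nonneg _ _ (by norm_num)]
    exact le_min (h.totalReassignments_le_opt_mul hE hn) (h.totalReassignments_le_sqrt_mul hE hn)
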